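/- **Theorem.** For $\nu>0$ define $$C_\nu=\log\Big[(1+8\nu^2)\vee\log\Big(\frac{e}{2-4\nu}\Big)\Big]\quad\text{if }\nu<\tfrac12,\qquad C_\nu=\log(1+8\nu^2)\quad\text{if }\nu\ge\tfrac12 .$$ Then $C_\nu>0$, and the following holds for all integers $n\ge 1$, $1\le k\le p$ and all real $\theta>0$. Let $\mathcal B_0(k)$ be the set of vectors $v\in\mathbf R^p$ with Euclidean norm $1$ and at most $k$ nonzero coordinates. Let $\mathbf P_0^n$ be the joint law of $n$ i.i.d. random vectors with distribution $\mathcal N(0,I_p)$ and, for $v\in\mathcal B_0(k)$, let $\mathbf P_v^n$ be the joint law of $n$ i.i.d. random vectors with distribution $\mathcal N(0,I_p+\theta vv^\top)$. If $$\theta<\sqrt{\frac{k\log\left(C_\nu p/k^2+1\right)}{n}}\wedge\frac1{\sqrt2},$$ then $$\inf_\psi\Big\{\mathbf P_0^n(\psi=1)\vee\max_{v\in\mathcal B_0(k)}\mathbf P_v^n(\psi=0)\Big\}\ \ge\ \frac12-\nu,$$ where the infimum is over all tests, i.e. all measurable functions $\psi:(\mathbf R^p)^n\to\{0,1\}$ of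 the observations, and for every test $\psi$ the maximum over $v$ is attained. -/

import Mathlib

open MeasureTheory ProbabilityTheory

noncomputable section

namespace SparsePCA

/-- The set of unit vectors of `ℝ^p` (Euclidean norm) with at most `k` nonzero coordinates. -/
def sparseSphere (p k : ℕ) : Set (EuclideanSpace ℝ (Fin p)) :=
  {v | ‖v‖ = 1 ∧ (Finset.univ.filter (fun i => v i ≠ 0)).card ≤ k}

/-- The spiked covariance matrix `I_p + θ v vᵀ`. -/
def spikedCov {p : ℕ} (θ : ℝ) (v : EuclideanSpace ℝ (Fin p)) : Matrix (Fin p) (Fin p) ℝ :=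
  1 + θ • Matrix.vecMulVec (fun i => v i) (fun i => v i)

/-- The joint law of `n` i.i.d. samples from `N(0, I_p)`. -/
def nullLaw (p n : ℕ) : Measure (Fin n → EuclideanSpace ℝ (Fin p)) :=
  Measure.pi (fun _ => multivariateGaussian 0 (1 : Matrix (Fin p) (Fin p) ℝ))

/-- The joint law of `n` i.i.d. samples from `N(0, I_p + θ v vᵀ)`. -/
def spikedLaw {p : ℕ} (n : ℕ) (θ : ℝ) (v : EuclideanSpace ℝ (Fin p)) :
    Measure (Fin n → EuclideanSpace ℝ (Fin p)) :=
  Measure.pi (fun _ => multivariateGaussian 0 (spikedCov θ v))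

/-- A test: a measurable function of the `n` observations with values in `{0, 1}`. -/
def Test (p n : ℕ) : Type :=
  {ψ : (Fin n → EuclideanSpace ℝ (Fin p)) → Fin 2 // Measurable ψ}

/-- The type I error, the probability under the null hypothesis that `ψ = 1`. -/
def typeIError {p n : ℕ} (ψ : Test p n) : ℝ :=
  (nullLaw p n).real {x | ψ.1 x = 1}

/-- The type II error at `v`, the probability under the spiked law that `ψ = 0`. -/
def typeIIError {p n : ℕ} (θ : ℝ) (ψ : Test p n) (v : EuclideanSpace ℝ (Fin p)) : ℝ :=
  (spikedLaw n θ v).real {x | ψ.1 x = 0}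

/-- The maximum of the type I error and of the largest type II error over `k`-sparse unit `v`. -/
def worstCaseError {p n : ℕ} (k : ℕ) (θ : ℝ) (ψ : Test p n) : ℝ :=
  max (typeIError ψ) (⨆ v : sparseSphere p k, typeIIError θ ψ v)

/-- The constant `C_ν`. For `ν ≥ 1/2` the second term of the maximum is infinite or undefined
and is left out. -/
def detectionConst (ν : ℝ) : ℝ :=
  if ν < 1 / 2 then
    Real.log (max (1 + 8 * ν ^ 2) (Real.log (Real.exp 1 / (2 - 4 * ν))))
  else Real.log (1 + 8 * ν ^ 2)

/-- The detection level: the minimum of `√(k log(C_ν p / k² + 1) / n)` and `1 / √2`. -/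
def detectionLevel (ν : ℝ) (p n k : ℕ) : ℝ :=
  min (Real.sqrt ((k : ℝ) * Real.log (detectionConst ν * (p : ℝ) / (k : ℝ) ^ 2 + 1) / (n : ℝ)))
    (1 / Real.sqrt 2)

end SparsePCA

end

/-!
The lower bound is a second moment argument. Put the uniform prior on the vectors `1_S / √k`, where
`S` runs over the `k`-subsets of the coordinates. The worst type II error of a test is at least its
average over the prior, so the test separates the null law from the mixture of the spiked laws, and
its two errors are controlled by the second moment of the likelihood ratio of the mixture.

Under the null law, the likelihood ratios of the spikes `u` and `v` for one observation have
correlation `(1 - θ² ⟪u, v⟫²)^(-1/2)` (`lintegral_spikeDensity_mul`). The ratio for `v` is a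
function of `⟪v, x⟫` alone (`multivariateGaussian_spikedCov_eq_withDensity`), so this is a
one-dimensional Gaussian integral under the law of `⟪v, x⟫` for the spike `u`. For `n` observations and two vectors
of the prior, the correlation is at most `(1 + C p / k²) ^ #(S ∩ T)` as soon as `θ` is below the
detection level with constant `C` (`ratioCorrelation_flatVector_le`). The size of `S ∩ T` is
hypergeometric, and its generating function is bounded by that of a binomial variable
(`sum_pow_card_inter_le`), which bounds the second moment by `(1 + C / k) ^ k ≤ exp C`
(`integral_mixtureRatio_sq_le`).

If both errors are at most `m < 1/2` and the second moment is at most `1 + α`, the Cauchy-Schwarz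
inequality gives `m (1 - m) ≥ 1 / (4 + α)` (`sq_one_sub_errors_le`, `inv_four_add_le_of_sq_le`).
With `exp C = 1 + α`, each of the two terms in the definition of `detectionConst` then forces
`m ≥ 1/2 - ν` (`half_sub_le_of_sq_le`).

The largest type II error is attained because the sparse sphere is compact and the error is
continuous on it: two errors differ by at most the `L²` distance of the likelihood ratios, an
explicit function of `⟪u, v⟫` that vanishes at `⟪u, v⟫ = 1` (`sq_sub_spikedLaw_real_le`).
-/

namespace SparsePCA

/-! ### Densities of product measures -/

section ProductDensity

variable {ι Ω : Type*} [Fintype ι] [MeasurableSpace Ω]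

/-- Tonelli's theorem for a product of functions of distinct coordinates. -/
lemma lintegral_pi_prod (μ : Measure Ω) [IsProbabilityMeasure μ] {f : ι → Ω → ENNReal}
    (hf : ∀ i, Measurable (f i)) :
    ∫⁻ x, ∏ i, f i (x i) ∂(Measure.pi fun _ : ι => μ) = ∏ i, ∫⁻ y, f i y ∂μ := by
  refine (lintegral_prod_eq_prod_lintegral_of_indepFun Finset.univ
    (fun i (x : ι → Ω) => f i (x i)) (iIndepFun_pi fun i => (hf i).aemeasurable)
    fun i => (hf i).comp (measurable_pi_apply i)).trans ?_
  refine Finset.prod_congr rfl fun i _ => ?_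
  exact (measurePreserving_eval (fun _ : ι => μ) i).lintegral_comp (hf i)

lemma pi_withDensity (μ : Measure Ω) [IsProbabilityMeasure μ] {f : Ω → ENNReal}
    (hf : Measurable f) [IsProbabilityMeasure (μ.withDensity f)] :
    Measure.pi (fun _ : ι => μ.withDensity f) =
      (Measure.pi fun _ : ι => μ).withDensity fun x => ∏ i, f (x i) := by
  refine Measure.pi_eq fun s hs => ?_
  rw [withDensity_apply _ (MeasurableSet.univ_pi hs),
    ← lintegral_indicator (MeasurableSet.univ_pi hs)]
  have key : (Set.univ.pi s).indicator (fun x : ι → Ω => ∏ i, f (x i)) =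
      fun x => ∏ i, (s i).indicator f (x i) := by
    ext x
    by_cases hx : x ∈ Set.univ.pi s
    · rw [Set.indicator_of_mem hx]
      exact Finset.prod_congr rfl fun i _ => (Set.indicator_of_mem (hx i trivial) _).symm
    · rw [Set.indicator_of_notMem hx]
      obtain ⟨i, hi⟩ : ∃ i, x i ∉ s i := by simpa using hx
      exact (Finset.prod_eq_zero (Finset.mem_univ i) (Set.indicator_of_notMem hi _)).symm
  rw [key, lintegral_pi_prod μ fun i => hf.indicator (hs i)]
  refine Finset.prod_congr rfl fun i _ => ?_
  rw [lintegral_indicator (hs i), withDensity_apply _ (hs i)]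

end ProductDensity

/-! ### Testing against a density with bounded second moment -/

section Testing

variable {Ω : Type*} [MeasurableSpace Ω] {P : Measure Ω}

lemma sq_integral_mul_le {f g : Ω → ℝ} (hf : MemLp f 2 P) (hg : MemLp g 2 P) :
    (∫ x, f x * g x ∂P) ^ 2 ≤ (∫ x, f x ^ 2 ∂P) * ∫ x, g x ^ 2 ∂P := by
  have h := discrim_le_zero (a := ∫ x, f x ^ 2 ∂P) (b := 2 * ∫ x, f x * g x ∂P)
    (c := ∫ x, g x ^ 2 ∂P) fun t => by
      have e : ∫ x, (t * f x + g x) ^ 2 ∂P = (∫ x, f x ^ 2 ∂P) * (t * t) +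
          2 * (∫ x, f x * g x ∂P) * t + ∫ x, g x ^ 2 ∂P := by
        have : ∀ x, (t * f x + g x) ^ 2 =
            (t * t) * f x ^ 2 + (2 * t) * (f x * g x) + g x ^ 2 := fun x => by ring
        simp_rw [this]
        have hfg : Integrable (fun x => f x * g x) P := hf.integrable_mul hg
        have hsum : Integrable (fun x => (t * t) * f x ^ 2 + (2 * t) * (f x * g x)) P :=
          (hf.integrable_sq.const_mul _).add (hfg.const_mul _)
        rw [integral_add hsum hg.integrable_sq,
          integral_add (hf.integrable_sq.const_mul _) (hfg.const_mul _),
          integral_const_mul, integral_const_mul]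
        ring
      rw [← e]
      exact integral_nonneg fun x => sq_nonneg _
  unfold discrim at h
  linarith

/-- The chi-square bound for a two-point test: `L` is the likelihood ratio of the alternative with
respect to `P`, and `A` the rejection region. It is the Cauchy-Schwarz inequality for the centered
variables `1_A - P(A)` and `L - 1`. -/
lemma sq_one_sub_errors_le [IsProbabilityMeasure P] {L : Ω → ℝ} (hL : MemLp L 2 P)
    (hL1 : ∫ x, L x ∂P = 1) {A : Set Ω} (hA : MeasurableSet A) :
    (1 - P.real A - ∫ x in Aᶜ, L x ∂P) ^ 2 ≤
      P.real A * (1 - P.real A) * ((∫ x, L x ^ 2 ∂P) - 1) := by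
  set a := P.real A with ha
  have hLi : Integrable L P := hL.integrable (by norm_num)
  have hone : MemLp (A.indicator fun _ => (1 : ℝ)) 2 P :=
    memLp_indicator_const 2 hA 1 (Or.inr (measure_ne_top _ _))
  have hi1 : Integrable (A.indicator fun _ => (1 : ℝ)) P := hone.integrable (by norm_num)
  have hI1 : ∫ x, A.indicator (fun _ => (1 : ℝ)) x ∂P = a := by
    rw [integral_indicator hA]; simp [ha]
  have hIL : Integrable (fun x => A.indicator L x) P := hLi.indicator hA
  have hsplit : ∫ x, A.indicator L x ∂P = 1 - ∫ x in Aᶜ, L x ∂P := by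
    rw [integral_indicator hA, ← hL1, ← integral_add_compl hA hLi]; ring
  have hf : MemLp (fun x => A.indicator (fun _ => (1 : ℝ)) x - a) 2 P := hone.sub (memLp_const a)
  have hg : MemLp (fun x => L x - 1) 2 P := hL.sub (memLp_const 1)
  have h := sq_integral_mul_le hf hg
  have e1 : ∫ x, (A.indicator (fun _ => (1 : ℝ)) x - a) * (L x - 1) ∂P =
      1 - a - ∫ x in Aᶜ, L x ∂P := by
    have : ∀ x, (A.indicator (fun _ => (1 : ℝ)) x - a) * (L x - 1) =
        A.indicator L x - A.indicator (fun _ => (1 : ℝ)) x - (a * L x - a) := fun x => by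
      by_cases hx : x ∈ A
      · simp only [Set.indicator_of_mem hx]; ring
      · simp only [Set.indicator_of_notMem hx]; ring
    simp_rw [this]
    have hl : Integrable (fun x => A.indicator L x - A.indicator (fun _ => (1 : ℝ)) x) P :=
      hIL.sub hi1
    have hr : Integrable (fun x => a * L x - a) P := (hLi.const_mul a).sub (integrable_const a)
    rw [integral_sub hl hr,
      integral_sub hIL hi1, integral_sub (hLi.const_mul a) (integrable_const a),
      integral_const_mul, hI1, hL1, hsplit]
    simp
    ring
  have e2 : ∫ x, (A.indicator (fun _ => (1 : ℝ)) x - a) ^ 2 ∂P = a * (1 - a) := by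
    have : ∀ x, (A.indicator (fun _ => (1 : ℝ)) x - a) ^ 2 =
        (1 - 2 * a) * A.indicator (fun _ => (1 : ℝ)) x + a ^ 2 := fun x => by
      by_cases hx : x ∈ A
      · simp only [Set.indicator_of_mem hx]; ring
      · simp only [Set.indicator_of_notMem hx]; ring
    simp_rw [this]
    rw [integral_add (hi1.const_mul _) (integrable_const _), integral_const_mul, hI1]
    simp
    ring
  have e3 : ∫ x, (L x - 1) ^ 2 ∂P = (∫ x, L x ^ 2 ∂P) - 1 := by
    have : ∀ x, (L x - 1) ^ 2 = L x ^ 2 - (2 * L x - 1) := fun x => by ring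
    simp_rw [this]
    have hr : Integrable (fun x => 2 * L x - 1) P := (hLi.const_mul 2).sub (integrable_const 1)
    rw [integral_sub hL.integrable_sq hr,
      integral_sub (hLi.const_mul 2) (integrable_const 1), integral_const_mul, hL1]
    norm_num
  rwa [e1, e2, e3] at h

end Testing

/-- If both errors of a test are at most `m < 1/2`, the chi-square bound with divergence `α` forces
`m (1 - m) ≥ 1 / (4 + α)`. -/
lemma inv_four_add_le_of_sq_le {a b m α : ℝ} (ha : a ≤ m) (hb : b ≤ m)
    (hm : m < 1 / 2) (hα : 0 ≤ α) (h : (1 - a - b) ^ 2 ≤ a * (1 - a) * α) :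
    1 / (4 + α) ≤ m * (1 - m) := by
  have h1 : (1 - 2 * m) ^ 2 ≤ (1 - a - b) ^ 2 :=
    pow_le_pow_left₀ (by linarith) (by linarith) 2
  have h2 : a * (1 - a) ≤ m * (1 - m) := by nlinarith
  have h3 : a * (1 - a) * α ≤ m * (1 - m) * α := mul_le_mul_of_nonneg_right h2 hα
  rw [div_le_iff₀ (by linarith)]
  nlinarith

/-- The two regimes of `detectionConst`: the first term of the maximum gives the bound through
`(1/2 - m)² ≤ α / (4 (4 + α))`, the second one through `m ≥ 1 / (4 + α) ≥ exp (-α) / 4`. -/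
lemma half_sub_le_of_sq_le {ν a b m α : ℝ} (hν : 0 < ν) (hν2 : ν < 1 / 2) (ha : a ≤ m)
    (hb : b ≤ m) (h : (1 - a - b) ^ 2 ≤ a * (1 - a) * α)
    (hα : 1 + α ≤ max (1 + 8 * ν ^ 2) (Real.log (Real.exp 1 / (2 - 4 * ν)))) (hα0 : 0 ≤ α) :
    1 / 2 - ν ≤ m := by
  by_cases hm : m < 1 / 2
  swap
  · linarith
  have key := inv_four_add_le_of_sq_le ha hb hm hα0 h
  rcases le_max_iff.1 hα with hc | hc
  · have h4 : 1 / (4 + 8 * ν ^ 2) ≤ 1 / (4 + α) :=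
      one_div_le_one_div_of_le (by linarith) (by linarith)
    have h5 : 1 ≤ m * (1 - m) * (4 + 8 * ν ^ 2) := by
      rw [← div_le_iff₀ (by positivity)]; linarith
    by_contra! hcon
    have h6 : m * (1 - m) ≤ 1 / 4 - ν ^ 2 := by nlinarith
    have h7 : m * (1 - m) * (4 + 8 * ν ^ 2) ≤ (1 / 4 - ν ^ 2) * (4 + 8 * ν ^ 2) :=
      mul_le_mul_of_nonneg_right h6 (by positivity)
    nlinarith [pow_pos hν 2, pow_pos hν 4]
  · have h24 : 0 < 2 - 4 * ν := by linarith
    rw [Real.log_div (Real.exp_ne_zero _) h24.ne', Real.log_exp] at hc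
    have h5 : 2 - 4 * ν ≤ Real.exp (-α) := by
      rw [← Real.exp_log h24]
      exact Real.exp_le_exp.2 (by linarith)
    have h6 : Real.exp (-α) ≤ 1 / (1 + α) := by
      rw [Real.exp_neg, one_div]
      exact inv_anti₀ (by linarith) (by linarith [Real.add_one_le_exp α])
    have h7 : 1 / (1 + α) ≤ 4 * (1 / (4 + α)) := by
      rw [mul_one_div, div_le_div_iff₀ (by linarith) (by linarith)]
      linarith
    nlinarith [mul_self_nonneg m]

/-! ### Intersections of random subsets -/

/-- The fraction of the `k`-subsets of a `p`-set that contain a given `a`-subset is at most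
`(k / p) ^ a`. -/
lemma choose_sub_mul_pow_le {p k a : ℕ} (hk : k ≤ p) (ha : a ≤ k) :
    ((p - a).choose (k - a) : ℝ) * (p : ℝ) ^ a ≤ (p.choose k : ℝ) * (k : ℝ) ^ a := by
  induction a with
  | zero => simp
  | succ a ih =>
    have ih := ih (by omega)
    obtain ⟨q, rfl⟩ : ∃ q, p = a + 1 + q := ⟨p - (a + 1), by omega⟩
    obtain ⟨l, rfl⟩ : ∃ l, k = a + 1 + l := ⟨k - (a + 1), by omega⟩
    rw [show a + 1 + q - a = q + 1 by omega, show a + 1 + l - a = l + 1 by omega] at ih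
    rw [show a + 1 + q - (a + 1) = q by omega, show a + 1 + l - (a + 1) = l by omega]
    have hrec : ((q : ℝ) + 1) * q.choose l = (q + 1).choose (l + 1) * ((l : ℝ) + 1) := by
      exact_mod_cast Nat.add_one_mul_choose_eq q l
    have hlq : (l : ℝ) ≤ q := by exact_mod_cast (by omega : l ≤ q)
    set X : ℝ := ((a + 1 + q : ℕ) : ℝ) with hX
    set Y : ℝ := ((a + 1 + l : ℕ) : ℝ) with hY
    have hX' : X = a + 1 + q := by simp [hX]
    have hY' : Y = a + 1 + l := by simp [hY]
    have hratio : ((l : ℝ) + 1) * X ≤ ((q : ℝ) + 1) * Y := by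
      rw [hX', hY']
      nlinarith [(Nat.cast_nonneg a : (0 : ℝ) ≤ a)]
    have hYpos : 0 ≤ Y := Nat.cast_nonneg _
    have hXpos : 0 ≤ X := Nat.cast_nonneg _
    refine le_of_mul_le_mul_left ?_ (by positivity : (0 : ℝ) < (q : ℝ) + 1)
    calc ((q : ℝ) + 1) * (q.choose l * X ^ (a + 1))
        = ((q + 1).choose (l + 1) * X ^ a) * ((l + 1) * X) := by
          rw [pow_succ]; linear_combination X ^ a * X * hrec
      _ ≤ ((q + 1).choose (l + 1) * X ^ a) * ((q + 1) * Y) :=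
          mul_le_mul_of_nonneg_left hratio (by positivity)
      _ ≤ (((a + 1 + q).choose (a + 1 + l) : ℝ) * Y ^ a) * ((q + 1) * Y) :=
          mul_le_mul_of_nonneg_right ih (by positivity)
      _ = ((q : ℝ) + 1) * (((a + 1 + q).choose (a + 1 + l) : ℝ) * Y ^ (a + 1)) := by ring

/-- The probability generating function of the hypergeometric variable `#(S ∩ T)`, with `T` a
uniform `k`-subset, is at most that of a binomial variable: expand `(1 + y) ^ #(S ∩ T)` over the
subsets of `S ∩ T` and exchange the sums. -/
lemma sum_pow_card_inter_le {p k : ℕ} (hk : k ≤ p) {S : Finset (Fin p)} (hS : S.card = k)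
    {y : ℝ} (hy : 0 ≤ y) :
    ∑ T ∈ Finset.powersetCard k (Finset.univ : Finset (Fin p)), (1 + y) ^ (S ∩ T).card ≤
      (p.choose k : ℝ) * (1 + k / p * y) ^ k := by
  have expand : ∀ T : Finset (Fin p), (1 + y) ^ (S ∩ T).card =
      ∑ A ∈ S.powerset, if A ⊆ T then y ^ A.card else 0 := fun T => by
    rw [← Finset.prod_const, Finset.prod_one_add, ← Finset.sum_filter]
    simp only [Finset.prod_const]
    refine Finset.sum_congr ?_ fun _ _ => rfl
    ext A
    rw [Finset.mem_powerset, Finset.mem_filter, Finset.mem_powerset, Finset.subset_inter_iff]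
  simp_rw [expand]
  rw [Finset.sum_comm]
  have hfin : (1 + (k : ℝ) / p * y) ^ k = ∑ A ∈ S.powerset, ((k : ℝ) / p * y) ^ A.card := by
    rw [← hS, ← Finset.prod_const, Finset.prod_one_add]
    simp
  rw [hfin, Finset.mul_sum]
  refine Finset.sum_le_sum fun A hA => ?_
  have hAS : A.card ≤ k := hS ▸ Finset.card_le_card (Finset.mem_powerset.1 hA)
  rw [← Finset.sum_filter, Finset.sum_const, nsmul_eq_mul,
    Finset.card_filter_powersetCard_subset _ _ _ (Finset.subset_univ A) hAS, Finset.card_univ,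
    Fintype.card_fin, mul_pow, div_pow, ← mul_assoc]
  refine mul_le_mul_of_nonneg_right ?_ (by positivity)
  rcases Nat.eq_zero_or_pos p with rfl | hp
  · have hk0 : k = 0 := by omega
    subst hk0
    have : A.card = 0 := by omega
    simp [this]
  · rw [← mul_div_assoc, le_div_iff₀ (by positivity)]
    exact choose_sub_mul_pow_le hk hAS

/-! ### Gaussian likelihood ratios -/

lemma gaussianPDFReal_mul_exp_sq {s : NNReal} (hs : s ≠ 0) {β : ℝ} (hβ : 2 * β * s < 1) (y : ℝ) :
    gaussianPDFReal 0 s y * Real.exp (β * y ^ 2) =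
      (√(1 - 2 * β * s))⁻¹ * gaussianPDFReal 0 (s / (1 - 2 * β * s).toNNReal) y := by
  have h1 : 0 < 1 - 2 * β * s := by linarith
  have hs' : (0 : ℝ) < s := by positivity
  simp only [gaussianPDFReal, NNReal.coe_div, Real.coe_toNNReal _ h1.le, sub_zero]
  rw [mul_assoc, ← Real.exp_add, ← mul_assoc]
  congr 1
  · rw [← mul_div_assoc, Real.sqrt_div (by positivity), inv_div, inv_mul_eq_div,
      div_div_cancel_left']
    exact (Real.sqrt_pos.2 h1).ne'
  · congr 1
    field_simp
    ring

/-- A centered Gaussian law tilted by `exp (β y²)` is, up to its mass, a centered Gaussian law. -/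
lemma gaussianReal_withDensity_exp_sq {s : NNReal} (hs : s ≠ 0) {β : ℝ} (hβ : 2 * β * s < 1) :
    (gaussianReal 0 s).withDensity (fun y => ENNReal.ofReal (Real.exp (β * y ^ 2))) =
      ENNReal.ofReal (√(1 - 2 * β * s))⁻¹ • gaussianReal 0 (s / (1 - 2 * β * s).toNNReal) := by
  have h1 : 0 < 1 - 2 * β * s := by linarith
  have h2 : s / (1 - 2 * β * s).toNNReal ≠ 0 :=
    div_ne_zero hs (by simpa using h1)
  rw [gaussianReal_of_var_ne_zero _ hs, gaussianReal_of_var_ne_zero _ h2,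
    ← withDensity_mul _ (measurable_gaussianPDF _ _) (by fun_prop),
    ← withDensity_smul _ (measurable_gaussianPDF _ _)]
  congr 1
  ext y
  simp only [Pi.mul_apply, Pi.smul_apply, smul_eq_mul, gaussianPDF]
  rw [← ENNReal.ofReal_mul (gaussianPDFReal_nonneg _ _ _), ← ENNReal.ofReal_mul (by positivity),
    gaussianPDFReal_mul_exp_sq hs hβ]

/-- The density of `N(0, 1 + θ)` with respect to `N(0, 1)`. -/
noncomputable def spikeDensity (θ y : ℝ) : ℝ := (√(1 + θ))⁻¹ * Real.exp (θ / (2 * (1 + θ)) * y ^ 2)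

@[fun_prop]
lemma measurable_spikeDensity (θ : ℝ) : Measurable (spikeDensity θ) := by
  unfold spikeDensity; fun_prop

lemma spikeDensity_nonneg (θ y : ℝ) : 0 ≤ spikeDensity θ y := by
  unfold spikeDensity; positivity

lemma gaussianReal_withDensity_spikeDensity {θ : ℝ} (hθ : 0 < θ) :
    (gaussianReal 0 1).withDensity (fun y => ENNReal.ofReal (spikeDensity θ y)) =
      gaussianReal 0 (1 + θ).toNNReal := by
  have h0 : 0 < 1 + θ := by linarith
  have h1 : 1 - 2 * (θ / (2 * (1 + θ))) * ((1 : NNReal) : ℝ) = (1 + θ)⁻¹ := by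
    push_cast; field_simp; ring
  have h := gaussianReal_withDensity_exp_sq (s := 1) one_ne_zero (β := θ / (2 * (1 + θ)))
    (by have : 0 < (1 + θ)⁻¹ := by positivity
        linarith)
  rw [h1] at h
  have h2 : (fun y => ENNReal.ofReal (spikeDensity θ y)) = ENNReal.ofReal (√(1 + θ))⁻¹ •
      fun y => ENNReal.ofReal (Real.exp (θ / (2 * (1 + θ)) * y ^ 2)) := by
    ext y
    simp only [Pi.smul_apply, smul_eq_mul, spikeDensity]
    rw [ENNReal.ofReal_mul (by positivity)]
  rw [h2, withDensity_smul _ (by fun_prop), h, smul_smul, ← ENNReal.ofReal_mul (by positivity),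
    Real.sqrt_inv, inv_inv, inv_mul_cancel₀ (Real.sqrt_pos.2 h0).ne', ENNReal.ofReal_one, one_smul,
    Real.toNNReal_inv, one_div, inv_inv]

/-- The mean of the likelihood ratio `spikeDensity θ` under a centered Gaussian law of variance
`1 + θ c²`. -/
lemma lintegral_spikeDensity {θ c : ℝ} (hθ : 0 < θ) (hc : θ ^ 2 * c ^ 2 < 1) :
    ∫⁻ y, ENNReal.ofReal (spikeDensity θ y) ∂(gaussianReal 0 (1 + θ * c ^ 2).toNNReal) =
      ENNReal.ofReal (√(1 - θ ^ 2 * c ^ 2))⁻¹ := by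
  have h0 : 0 < 1 + θ := by linarith
  have hv : 0 < 1 + θ * c ^ 2 := by positivity
  have h1 : 1 - 2 * (θ / (2 * (1 + θ))) * (1 + θ * c ^ 2) = (1 - θ ^ 2 * c ^ 2) / (1 + θ) := by
    field_simp; ring
  have h2 : 0 < (1 - θ ^ 2 * c ^ 2) / (1 + θ) := div_pos (by linarith) h0
  have h := gaussianReal_withDensity_exp_sq (s := (1 + θ * c ^ 2).toNNReal)
    (by simpa using hv) (β := θ / (2 * (1 + θ)))
    (by rw [Real.coe_toNNReal _ hv.le]; linarith)
  rw [Real.coe_toNNReal _ hv.le, h1] at h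
  have h3 := congrArg (fun μ : Measure ℝ => μ Set.univ) h
  simp only [withDensity_apply _ MeasurableSet.univ, Measure.restrict_univ, Measure.smul_apply,
    measure_univ, smul_eq_mul, mul_one] at h3
  simp_rw [spikeDensity, ENNReal.ofReal_mul (inv_nonneg.2 (Real.sqrt_nonneg (1 + θ)))]
  rw [lintegral_const_mul _ (by fun_prop), h3, ← ENNReal.ofReal_mul (by positivity),
    Real.sqrt_div (by linarith)]
  congr 1
  have := (Real.sqrt_pos.2 h0).ne'
  field_simp

open scoped RealInnerProductSpace Matrix

variable {p : ℕ}

lemma dotProduct_spikedCov_mulVec (θ : ℝ) (v x y : EuclideanSpace ℝ (Fin p)) :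
    (fun i => x i) ⬝ᵥ spikedCov θ v *ᵥ (fun i => y i) = ⟪x, y⟫ + θ * (⟪v, x⟫ * ⟪v, y⟫) := by
  have e : ∀ a b : EuclideanSpace ℝ (Fin p), ⟪a, b⟫ = (fun i => a i) ⬝ᵥ (fun i => b i) := by
    intro a b
    simp [PiLp.inner_apply, dotProduct, mul_comm]
  rw [spikedCov, Matrix.add_mulVec, Matrix.one_mulVec, Matrix.smul_mulVec,
    Matrix.vecMulVec_mulVec, dotProduct_add, dotProduct_smul, e, e, e]
  rw [dotProduct_comm (fun i => v i) (fun i => x i), op_smul_eq_smul, dotProduct_smul]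
  simp only [smul_eq_mul]
  ring

lemma posSemidef_spikedCov {θ : ℝ} (hθ : 0 < θ) (v : EuclideanSpace ℝ (Fin p)) :
    (spikedCov θ v).PosSemidef := by
  refine Matrix.PosSemidef.one.add (Matrix.PosSemidef.smul ?_ hθ.le)
  simpa using Matrix.posSemidef_vecMulVec_self_star (fun i => v i)

lemma charFun_spiked {θ : ℝ} (hθ : 0 < θ) (v t : EuclideanSpace ℝ (Fin p)) :
    charFun (multivariateGaussian 0 (spikedCov θ v)) t =
      Complex.exp (-((‖t‖ ^ 2 + θ * ⟪v, t⟫ ^ 2 : ℝ) : ℂ) / 2) := by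
  rw [charFun_multivariateGaussian (posSemidef_spikedCov hθ v),
    dotProduct_spikedCov_mulVec θ v t t, real_inner_self_eq_norm_sq, inner_zero_right]
  congr 1
  push_cast
  ring

/-- The law of a linear statistic is determined by the characteristic function along a line. -/
lemma map_inner_eq_gaussianReal {μ : Measure (EuclideanSpace ℝ (Fin p))} [IsProbabilityMeasure μ]
    {u : EuclideanSpace ℝ (Fin p)} {s : NNReal}
    (h : ∀ t : ℝ, charFun μ (t • u) = Complex.exp (-(s * t ^ 2 : ℝ) / 2)) :
    μ.map (fun x => ⟪u, x⟫) = gaussianReal 0 s := by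
  have : IsProbabilityMeasure (μ.map (fun x => ⟪u, x⟫)) :=
    Measure.isProbabilityMeasure_map (by fun_prop)
  refine Measure.ext_of_charFun ?_
  ext t
  rw [charFun_gaussianReal, charFun_apply_real, integral_map (by fun_prop) (by fun_prop)]
  have e : ∀ x : EuclideanSpace ℝ (Fin p),
      Complex.exp (t * (⟪u, x⟫ : ℝ) * Complex.I) = Complex.exp ((⟪x, t • u⟫ : ℝ) * Complex.I) := by
    intro x
    rw [inner_smul_right, real_inner_comm]
    push_cast
    rfl
  simp_rw [e]
  rw [← charFun_apply, h]
  congr 1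
  push_cast
  ring

lemma map_inner_spiked {θ : ℝ} (hθ : 0 < θ) (v u : EuclideanSpace ℝ (Fin p)) (hu : ‖u‖ = 1) :
    (multivariateGaussian 0 (spikedCov θ v)).map (fun x => ⟪u, x⟫) =
      gaussianReal 0 (1 + θ * ⟪v, u⟫ ^ 2).toNNReal := by
  refine map_inner_eq_gaussianReal fun t => ?_
  rw [charFun_spiked hθ, Real.coe_toNNReal _ (by positivity), norm_smul, hu, inner_smul_right,
    mul_one, Real.norm_eq_abs, sq_abs]
  congr 1
  push_cast
  ring

lemma map_inner_stdGaussian (u : EuclideanSpace ℝ (Fin p)) (hu : ‖u‖ = 1) :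
    (stdGaussian (EuclideanSpace ℝ (Fin p))).map (fun x => ⟪u, x⟫) = gaussianReal 0 1 := by
  refine map_inner_eq_gaussianReal fun t => ?_
  rw [charFun_stdGaussian, norm_smul, hu, mul_one, Real.norm_eq_abs, ← Complex.ofReal_pow, sq_abs]
  simp

lemma indepFun_inner_stdGaussian {u w : EuclideanSpace ℝ (Fin p)} (h : ⟪u, w⟫ = 0) :
    IndepFun (fun x => ⟪u, x⟫) (fun x => ⟪w, x⟫) (stdGaussian (EuclideanSpace ℝ (Fin p))) := by
  refine HasGaussianLaw.indepFun_of_covariance_eq_zero ?_ ?_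
  · exact (IsGaussian.hasGaussianLaw_id (μ := stdGaussian (EuclideanSpace ℝ (Fin p)))).map_fun
      ((innerSL ℝ u).prod (innerSL ℝ w))
  · rw [← covarianceBilin_apply_eq_cov IsGaussian.memLp_two_id, covarianceBilin_stdGaussian]
    exact h

/-- The likelihood ratio of `N(0, I + θ v vᵀ)` with respect to `N(0, I)` depends on the observation
only through its component along `v`; the orthogonal component is independent of it and has the
same law under both. -/
lemma multivariateGaussian_spikedCov_eq_withDensity {θ : ℝ} (hθ : 0 < θ)
    {v : EuclideanSpace ℝ (Fin p)} (hv : ‖v‖ = 1) :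
    multivariateGaussian 0 (spikedCov θ v) =
      (stdGaussian (EuclideanSpace ℝ (Fin p))).withDensity
        fun x => ENNReal.ofReal (spikeDensity θ ⟪v, x⟫) := by
  set γ := stdGaussian (EuclideanSpace ℝ (Fin p))
  have hmass : ∫⁻ y, ENNReal.ofReal (spikeDensity θ y) ∂(gaussianReal 0 1) = 1 := by
    have := congrArg (fun μ : Measure ℝ => μ Set.univ) (gaussianReal_withDensity_spikeDensity hθ)
    simpa [withDensity_apply _ MeasurableSet.univ] using this
  have hfin : IsFiniteMeasure (γ.withDensity
      fun x => ENNReal.ofReal (spikeDensity θ ⟪v, x⟫)) := by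
    refine isFiniteMeasure_withDensity ?_
    rw [← lintegral_map (μ := γ) (f := fun y => ENNReal.ofReal (spikeDensity θ y))
      (g := fun x => ⟪v, x⟫) (by fun_prop) (by fun_prop), map_inner_stdGaussian v hv, hmass]
    exact ENNReal.one_ne_top
  refine Measure.ext_of_charFun ?_
  ext t
  -- `t = a v + w` with `w` orthogonal to `v`; the density only affects the factor of `a v`
  set a : ℝ := ⟪v, t⟫ with ha
  set w := t - a • v with hw
  have hvw : ⟪v, w⟫ = 0 := by
    rw [hw, inner_sub_right, inner_smul_right, real_inner_self_eq_norm_sq, hv, ← ha]; ring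
  have hnorm : ‖w‖ ^ 2 = ‖t‖ ^ 2 - a ^ 2 := by
    rw [hw, norm_sub_sq_real, inner_smul_right, norm_smul, hv, real_inner_comm, ← ha]
    simp only [mul_one, Real.norm_eq_abs, sq_abs]
    ring
  rw [charFun_spiked hθ, charFun_apply, integral_withDensity_eq_integral_toReal_smul
    (by fun_prop) (ae_of_all _ fun _ => ENNReal.ofReal_lt_top)]
  simp_rw [ENNReal.toReal_ofReal (spikeDensity_nonneg θ _)]
  have split : ∀ x : EuclideanSpace ℝ (Fin p),
      spikeDensity θ ⟪v, x⟫ • Complex.exp ((⟪x, t⟫ : ℝ) * Complex.I) =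
      ((spikeDensity θ ⟪v, x⟫ : ℂ) * Complex.exp (a * (⟪v, x⟫ : ℝ) * Complex.I)) *
        Complex.exp ((⟪w, x⟫ : ℝ) * Complex.I) := by
    intro x
    have ht : t = a • v + w := by rw [hw]; abel
    have : ⟪x, t⟫ = a * ⟪v, x⟫ + ⟪w, x⟫ := by
      conv_lhs => rw [ht]
      rw [inner_add_right, inner_smul_right, real_inner_comm v x, real_inner_comm w x]
    rw [this, mul_assoc (spikeDensity θ ⟪v, x⟫ : ℂ), ← Complex.exp_add, Complex.real_smul]
    congr 2
    push_cast
    ring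
  simp_rw [split]
  rw [(indepFun_inner_stdGaussian hvw).integral_fun_comp_mul_comp
    (f := fun y : ℝ => (spikeDensity θ y : ℂ) * Complex.exp (a * (y : ℝ) * Complex.I))
    (g := fun y : ℝ => Complex.exp ((y : ℝ) * Complex.I)) (by fun_prop) (by fun_prop)
    (by fun_prop) (by fun_prop)]
  have h1 : ∫ x, (spikeDensity θ ⟪v, x⟫ : ℂ) * Complex.exp (a * (⟪v, x⟫ : ℝ) * Complex.I) ∂γ =
      Complex.exp (-((1 + θ) * a ^ 2 : ℝ) / 2) := by
    rw [← integral_map (μ := γ) (φ := fun x => ⟪v, x⟫)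
      (f := fun y : ℝ => (spikeDensity θ y : ℂ) * Complex.exp (a * (y : ℝ) * Complex.I))
      (by fun_prop) (by fun_prop), map_inner_stdGaussian v hv]
    have h := charFun_gaussianReal (μ := 0) (v := (1 + θ).toNNReal) a
    rw [← gaussianReal_withDensity_spikeDensity hθ, charFun_apply_real,
      integral_withDensity_eq_integral_toReal_smul
        (by fun_prop) (ae_of_all _ fun _ => ENNReal.ofReal_lt_top)] at h
    simp_rw [ENNReal.toReal_ofReal (spikeDensity_nonneg θ _), Complex.real_smul] at h
    rw [h, Real.coe_toNNReal _ (by linarith)]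
    congr 1
    push_cast
    ring
  have h2 : ∫ x, Complex.exp ((⟪w, x⟫ : ℝ) * Complex.I) ∂γ = Complex.exp (-(‖w‖ ^ 2 : ℝ) / 2) := by
    have h := charFun_stdGaussian w
    rw [charFun_apply] at h
    simp_rw [real_inner_comm w] at h
    rw [h]
    push_cast
    rfl
  rw [h1, h2, ← Complex.exp_add, hnorm]
  congr 1
  push_cast
  ring

/-- The second moment of the likelihood ratios of two spiked models. -/
lemma lintegral_spikeDensity_mul {θ : ℝ} (hθ : 0 < θ) {u v : EuclideanSpace ℝ (Fin p)}
    (hu : ‖u‖ = 1) (hv : ‖v‖ = 1) (h : θ ^ 2 * ⟪u, v⟫ ^ 2 < 1) :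
    ∫⁻ x, ENNReal.ofReal (spikeDensity θ ⟪u, x⟫) * ENNReal.ofReal (spikeDensity θ ⟪v, x⟫)
      ∂(stdGaussian (EuclideanSpace ℝ (Fin p))) =
      ENNReal.ofReal (√(1 - θ ^ 2 * ⟪u, v⟫ ^ 2))⁻¹ := by
  rw [← lintegral_spikeDensity hθ h, ← map_inner_spiked hθ u v hv,
    lintegral_map (by fun_prop) (by fun_prop), multivariateGaussian_spikedCov_eq_withDensity hθ hu,
    lintegral_withDensity_eq_lintegral_mul _ (by fun_prop) (by fun_prop)]
  rfl

/-! ### Likelihood ratios of the samples -/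

/-- The likelihood ratio of `n` samples from `N(0, I + θ v vᵀ)` with respect to `N(0, I)`, for a
unit vector `v`. -/
noncomputable def sampleRatio (n : ℕ) (θ : ℝ) (v : EuclideanSpace ℝ (Fin p))
    (x : Fin n → EuclideanSpace ℝ (Fin p)) : ℝ :=
  ∏ i, spikeDensity θ ⟪v, x i⟫

@[fun_prop]
lemma measurable_sampleRatio (n : ℕ) (θ : ℝ) (v : EuclideanSpace ℝ (Fin p)) :
    Measurable (sampleRatio n θ v) := by
  unfold sampleRatio
  fun_prop

lemma sampleRatio_nonneg (n : ℕ) (θ : ℝ) (v : EuclideanSpace ℝ (Fin p))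
    (x : Fin n → EuclideanSpace ℝ (Fin p)) : 0 ≤ sampleRatio n θ v x :=
  Finset.prod_nonneg fun _ _ => spikeDensity_nonneg θ _

instance (n : ℕ) : IsProbabilityMeasure (nullLaw p n) := by
  unfold nullLaw; infer_instance

instance (n : ℕ) (θ : ℝ) (v : EuclideanSpace ℝ (Fin p)) :
    IsProbabilityMeasure (spikedLaw n θ v) := by
  unfold spikedLaw; infer_instance

lemma spikedLaw_eq_withDensity (n : ℕ) {θ : ℝ} (hθ : 0 < θ) {v : EuclideanSpace ℝ (Fin p)}
    (hv : ‖v‖ = 1) :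
    spikedLaw n θ v =
      (nullLaw p n).withDensity fun x => ENNReal.ofReal (sampleRatio n θ v x) := by
  have h := multivariateGaussian_spikedCov_eq_withDensity hθ hv
  have hprob : IsProbabilityMeasure ((stdGaussian (EuclideanSpace ℝ (Fin p))).withDensity
      fun x => ENNReal.ofReal (spikeDensity θ ⟪v, x⟫)) := h ▸ inferInstance
  rw [spikedLaw, h, pi_withDensity _ (by fun_prop), nullLaw, multivariateGaussian_zero_one]
  congr 1
  ext x
  rw [sampleRatio, ENNReal.ofReal_prod_of_nonneg fun _ _ => spikeDensity_nonneg θ _]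

/-- The correlation under the null hypothesis of the likelihood ratios of `n` samples for two unit
vectors with inner product `c`. -/
noncomputable def ratioCorrelation (n : ℕ) (θ c : ℝ) : ℝ := (√(1 - θ ^ 2 * c ^ 2))⁻¹ ^ n

lemma ratioCorrelation_nonneg (n : ℕ) (θ c : ℝ) : 0 ≤ ratioCorrelation n θ c := by
  unfold ratioCorrelation; positivity

lemma sq_mul_sq_inner_lt_one {θ : ℝ} (hθ : 0 < θ) (hθ1 : θ < 1) {u v : EuclideanSpace ℝ (Fin p)}
    (hu : ‖u‖ = 1) (hv : ‖v‖ = 1) : θ ^ 2 * ⟪u, v⟫ ^ 2 < 1 := by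
  have h1 : |⟪u, v⟫| ≤ 1 := by simpa [hu, hv] using abs_real_inner_le_norm u v
  have h2 : ⟪u, v⟫ ^ 2 ≤ 1 := (sq_le_one_iff_abs_le_one _).2 h1
  have h3 : θ ^ 2 < 1 := by nlinarith
  nlinarith [sq_nonneg θ, sq_nonneg ⟪u, v⟫]

section Moments

variable (n : ℕ) {θ : ℝ} (hθ : 0 < θ) (hθ1 : θ < 1) {u v : EuclideanSpace ℝ (Fin p)}
  (hu : ‖u‖ = 1) (hv : ‖v‖ = 1)
include hθ hθ1 hu hv

lemma lintegral_sampleRatio_mul :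
    ∫⁻ x, ENNReal.ofReal (sampleRatio n θ u x * sampleRatio n θ v x) ∂(nullLaw p n) =
      ENNReal.ofReal (ratioCorrelation n θ ⟪u, v⟫) := by
  have e : ∀ x : Fin n → EuclideanSpace ℝ (Fin p),
      ENNReal.ofReal (sampleRatio n θ u x * sampleRatio n θ v x) =
      ∏ i, ENNReal.ofReal (spikeDensity θ ⟪u, x i⟫) * ENNReal.ofReal (spikeDensity θ ⟪v, x i⟫) := by
    intro x
    rw [ENNReal.ofReal_mul (sampleRatio_nonneg _ _ _ _), sampleRatio, sampleRatio,
      ENNReal.ofReal_prod_of_nonneg fun _ _ => spikeDensity_nonneg θ _,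
      ENNReal.ofReal_prod_of_nonneg fun _ _ => spikeDensity_nonneg θ _, Finset.prod_mul_distrib]
  simp_rw [e]
  rw [nullLaw, multivariateGaussian_zero_one, lintegral_pi_prod (ι := Fin n)
    (stdGaussian (EuclideanSpace ℝ (Fin p))) (f := fun _ y =>
      ENNReal.ofReal (spikeDensity θ ⟪u, y⟫) * ENNReal.ofReal (spikeDensity θ ⟪v, y⟫))
      fun _ => by fun_prop]
  rw [lintegral_spikeDensity_mul hθ hu hv (sq_mul_sq_inner_lt_one hθ hθ1 hu hv),
    Finset.prod_const, Finset.card_univ, Fintype.card_fin, ratioCorrelation,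
    ENNReal.ofReal_pow (by positivity)]

lemma integral_sampleRatio_mul :
    ∫ x, sampleRatio n θ u x * sampleRatio n θ v x ∂(nullLaw p n) =
      ratioCorrelation n θ ⟪u, v⟫ := by
  rw [integral_eq_lintegral_of_nonneg_ae
    (ae_of_all _ fun x => mul_nonneg (sampleRatio_nonneg _ _ _ _) (sampleRatio_nonneg _ _ _ _))
    (by fun_prop), lintegral_sampleRatio_mul n hθ hθ1 hu hv,
    ENNReal.toReal_ofReal (ratioCorrelation_nonneg _ _ _)]

end Moments

section OneSpike

variable (n : ℕ) {θ : ℝ} (hθ : 0 < θ) (hθ1 : θ < 1) {v : EuclideanSpace ℝ (Fin p)} (hv : ‖v‖ = 1)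
include hθ hv

include hθ1 in
lemma memLp_sampleRatio : MemLp (sampleRatio n θ v) 2 (nullLaw p n) := by
  rw [memLp_two_iff_integrable_sq (by fun_prop)]
  refine ⟨by fun_prop, ?_⟩
  rw [hasFiniteIntegral_iff_ofReal (ae_of_all _ fun x => sq_nonneg _)]
  simp_rw [sq]
  rw [lintegral_sampleRatio_mul n hθ hθ1 hv hv]
  exact ENNReal.ofReal_lt_top

lemma spikedLaw_real_eq_setIntegral {A : Set (Fin n → EuclideanSpace ℝ (Fin p))}
    (hA : MeasurableSet A) :
    (spikedLaw n θ v).real A = ∫ x in A, sampleRatio n θ v x ∂(nullLaw p n) := by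
  rw [measureReal_def, spikedLaw_eq_withDensity n hθ hv, withDensity_apply _ hA,
    integral_eq_lintegral_of_nonneg_ae (ae_of_all _ fun x => sampleRatio_nonneg _ _ _ _)
    (by fun_prop)]

end OneSpike

/-! ### The type II error as a function of the spike -/

/-- The error at two spikes differs by at most the `L²` distance of the likelihood ratios. -/
lemma sq_sub_spikedLaw_real_le (n : ℕ) {θ : ℝ} (hθ : 0 < θ) (hθ1 : θ < 1)
    {u v : EuclideanSpace ℝ (Fin p)} (hu : ‖u‖ = 1) (hv : ‖v‖ = 1)
    {A : Set (Fin n → EuclideanSpace ℝ (Fin p))} (hA : MeasurableSet A) :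
    ((spikedLaw n θ u).real A - (spikedLaw n θ v).real A) ^ 2 ≤
      2 * ratioCorrelation n θ 1 - 2 * ratioCorrelation n θ ⟪u, v⟫ := by
  have mu := memLp_sampleRatio n hθ hθ1 hu
  have mv := memLp_sampleRatio n hθ hθ1 hv
  have hone : MemLp (A.indicator fun _ => (1 : ℝ)) 2 (nullLaw p n) :=
    memLp_indicator_const 2 hA 1 (Or.inr (measure_ne_top _ _))
  have h := sq_integral_mul_le hone (mu.sub mv)
  have e1 : ∫ x, A.indicator (fun _ => (1 : ℝ)) x * (sampleRatio n θ u - sampleRatio n θ v) x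
      ∂(nullLaw p n) = (spikedLaw n θ u).real A - (spikedLaw n θ v).real A := by
    rw [spikedLaw_real_eq_setIntegral n hθ hu hA, spikedLaw_real_eq_setIntegral n hθ hv hA,
      ← integral_sub (mu.integrable (by norm_num)).integrableOn
        (mv.integrable (by norm_num)).integrableOn, ← integral_indicator hA]
    refine integral_congr_ae (ae_of_all _ fun x => ?_)
    by_cases hx : x ∈ A <;> simp [hx]
  have e2 : ∫ x, (A.indicator (fun _ => (1 : ℝ)) x) ^ 2 ∂(nullLaw p n) ≤ 1 := by
    have : ∀ x, (A.indicator (fun _ => (1 : ℝ)) x) ^ 2 = A.indicator (fun _ => (1 : ℝ)) x :=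
      fun x => by by_cases hx : x ∈ A <;> simp [hx]
    simp_rw [this]
    rw [integral_indicator hA]
    simp
  have e3 : ∫ x, ((sampleRatio n θ u - sampleRatio n θ v) x) ^ 2 ∂(nullLaw p n) =
      2 * ratioCorrelation n θ 1 - 2 * ratioCorrelation n θ ⟪u, v⟫ := by
    have : ∀ x, ((sampleRatio n θ u - sampleRatio n θ v) x) ^ 2 =
        (sampleRatio n θ u x * sampleRatio n θ u x + sampleRatio n θ v x * sampleRatio n θ v x) -
          2 * (sampleRatio n θ u x * sampleRatio n θ v x) := fun x => by
      simp only [Pi.sub_apply]; ring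
    simp_rw [this]
    have iu : Integrable (fun x => sampleRatio n θ u x * sampleRatio n θ u x) (nullLaw p n) :=
      mu.integrable_mul mu
    have iv : Integrable (fun x => sampleRatio n θ v x * sampleRatio n θ v x) (nullLaw p n) :=
      mv.integrable_mul mv
    have iuv : Integrable (fun x => sampleRatio n θ u x * sampleRatio n θ v x) (nullLaw p n) :=
      mu.integrable_mul mv
    have iadd : Integrable (fun x => sampleRatio n θ u x * sampleRatio n θ u x +
        sampleRatio n θ v x * sampleRatio n θ v x) (nullLaw p n) := iu.add iv
    rw [integral_sub iadd (iuv.const_mul 2), integral_add iu iv, integral_const_mul,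
      integral_sampleRatio_mul n hθ hθ1 hu hu, integral_sampleRatio_mul n hθ hθ1 hv hv,
      integral_sampleRatio_mul n hθ hθ1 hu hv, real_inner_self_eq_norm_sq,
      real_inner_self_eq_norm_sq, hu, hv, one_pow]
    ring
  rw [e1] at h
  rw [← e3]
  exact h.trans (mul_le_of_le_one_left (integral_nonneg fun x => sq_nonneg _) e2)

lemma continuousOn_spikedLaw_real (n : ℕ) {θ : ℝ} (hθ : 0 < θ) (hθ1 : θ < 1)
    {A : Set (Fin n → EuclideanSpace ℝ (Fin p))} (hA : MeasurableSet A) :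
    ContinuousOn (fun v => (spikedLaw n θ v).real A) (Metric.sphere 0 1) := by
  intro v hv
  have hv1 : ‖v‖ = 1 := by simpa using hv
  have hone : 0 < 1 - θ ^ 2 * ⟪v, v⟫ ^ 2 := by
    linarith [sq_mul_sq_inner_lt_one hθ hθ1 hv1 hv1]
  have hcont : ContinuousAt (fun u : EuclideanSpace ℝ (Fin p) =>
      √(2 * ratioCorrelation n θ 1 - 2 * ratioCorrelation n θ ⟪u, v⟫)) v := by
    unfold ratioCorrelation
    have h1 : ContinuousAt (fun u : EuclideanSpace ℝ (Fin p) =>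
        (√(1 - θ ^ 2 * ⟪u, v⟫ ^ 2))⁻¹) v :=
      ContinuousAt.inv₀ (by fun_prop) (Real.sqrt_pos.2 hone).ne'
    fun_prop
  have hlim := hcont.tendsto.mono_left (nhdsWithin_le_nhds (s := Metric.sphere 0 1))
  have h0 : √(2 * ratioCorrelation n θ 1 - 2 * ratioCorrelation n θ ⟪v, v⟫) = 0 := by
    rw [real_inner_self_eq_norm_sq, hv1]; simp
  rw [h0] at hlim
  refine tendsto_iff_dist_tendsto_zero.2 (squeeze_zero' (Filter.Eventually.of_forall fun _ =>
    dist_nonneg) ?_ hlim)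
  filter_upwards [self_mem_nhdsWithin] with u hu
  have hu1 : ‖u‖ = 1 := by simpa using hu
  rw [Real.dist_eq]
  exact Real.abs_le_sqrt (sq_sub_spikedLaw_real_le n hθ hθ1 hu1 hv1 hA)

lemma sparseSphere_subset_sphere (p k : ℕ) : sparseSphere p k ⊆ Metric.sphere 0 1 := by
  intro v hv
  simpa using hv.1

lemma isCompact_sparseSphere (p k : ℕ) : IsCompact (sparseSphere p k) := by
  have e : sparseSphere p k = Metric.sphere 0 1 ∩
      ⋃ S ∈ (Finset.univ.filter fun S : Finset (Fin p) => S.card ≤ k),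
        {v : EuclideanSpace ℝ (Fin p) | ∀ i ∉ S, v i = 0} := by
    ext v
    simp only [sparseSphere, Set.mem_ofPred_eq, Set.mem_inter_iff, mem_sphere_iff_norm, sub_zero,
      Set.mem_iUnion, Finset.mem_filter, Finset.mem_univ, true_and, exists_prop]
    refine and_congr_right fun _ => ⟨fun h => ⟨_, h, fun i hi => by simpa using hi⟩, ?_⟩
    rintro ⟨S, hS, hv⟩
    refine (Finset.card_le_card fun i hi => ?_).trans hS
    by_contra hiS
    exact (Finset.mem_filter.1 hi).2 (hv i hiS)
  rw [e]
  refine (isCompact_sphere 0 1).inter_right (Set.Finite.isClosed_biUnion (Finset.finite_toSet _)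
    fun S _ => ?_)
  simp only [Set.ofPred_forall]
  exact isClosed_iInter fun i => isClosed_iInter fun _ =>
    isClosed_eq (by fun_prop) continuous_const

/-! ### The prior: normalized indicators of `k`-subsets -/

/-- The vector with entries `1 / √k` on `S` and `0` elsewhere; a unit vector when `#S = k ≥ 1`. -/
noncomputable def flatVector (k : ℕ) (S : Finset (Fin p)) : EuclideanSpace ℝ (Fin p) :=
  WithLp.toLp 2 fun i => if i ∈ S then 1 / √(k : ℝ) else 0

lemma inner_flatVector (k : ℕ) (S T : Finset (Fin p)) :
    ⟪flatVector k S, flatVector k T⟫ = ((S ∩ T).card : ℝ) / k := by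
  have : ∀ i, ⟪flatVector k S i, flatVector k T i⟫ = if i ∈ S ∩ T then 1 / (k : ℝ) else 0 := by
    intro i
    simp only [flatVector, Finset.mem_inter]
    by_cases h1 : i ∈ S <;> by_cases h2 : i ∈ T <;> simp [h1, h2]
  rw [PiLp.inner_apply]
  simp_rw [this]
  rw [Finset.sum_ite_mem, Finset.univ_inter, Finset.sum_const, nsmul_eq_mul, mul_one_div]

lemma norm_flatVector {k : ℕ} (hk : 1 ≤ k) {S : Finset (Fin p)} (hS : S.card = k) :
    ‖flatVector k S‖ = 1 := by
  have hk0 : (k : ℝ) ≠ 0 := by positivity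
  have h : ‖flatVector k S‖ ^ 2 = 1 := by
    rw [← real_inner_self_eq_norm_sq, inner_flatVector, Finset.inter_self, hS, div_self hk0]
  exact (pow_eq_one_iff_of_nonneg (norm_nonneg _) two_ne_zero).1 h

lemma flatVector_mem_sparseSphere {k : ℕ} (hk : 1 ≤ k) {S : Finset (Fin p)} (hS : S.card = k) :
    flatVector k S ∈ sparseSphere p k := by
  refine ⟨norm_flatVector hk hS, hS ▸ Finset.card_le_card fun i hi => ?_⟩
  by_contra hiS
  exact (Finset.mem_filter.1 hi).2 (by simp [flatVector, hiS])

lemma ratioCorrelation_le_exp (n : ℕ) {θ c : ℝ} (h : θ ^ 2 * c ^ 2 ≤ 1 / 2) :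
    ratioCorrelation n θ c ≤ Real.exp (n * (θ ^ 2 * c ^ 2)) := by
  set t := θ ^ 2 * c ^ 2 with ht
  have ht0 : 0 ≤ t := by positivity
  rw [ratioCorrelation, ← ht, Real.exp_nat_mul]
  refine pow_le_pow_left₀ (by positivity) ?_ n
  rw [inv_le_comm₀ (Real.sqrt_pos.2 (by linarith)) (Real.exp_pos _), ← Real.exp_neg]
  refine Real.le_sqrt_of_sq_le ?_
  rw [← Real.exp_nat_mul, Real.exp_nat_mul, Real.exp_neg, inv_pow,
    inv_le_comm₀ (by positivity) (by linarith), ← Real.exp_nat_mul]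
  -- `1 / (1 - t) ≤ 1 + 2 t` for `0 ≤ t ≤ 1 / 2`
  have h1 : (1 - t)⁻¹ ≤ 1 + 2 * t := by
    rw [inv_le_iff_one_le_mul₀ (by linarith)]
    nlinarith
  have h2 := Real.add_one_le_exp (2 * t)
  push_cast
  linarith

/-- Below the detection level, the correlation of two likelihood ratios of the prior is at most
exponential in the size of the intersection of the supports. -/
lemma ratioCorrelation_flatVector_le {n k : ℕ} (hn : 1 ≤ n) (hk : 1 ≤ k) {θ y : ℝ} (hθ : 0 < θ)
    (hy : 0 ≤ y) (hθy : θ < √(k * Real.log (y + 1) / n)) (hθ2 : θ < 1 / √2)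
    {S T : Finset (Fin p)} (hS : S.card = k) :
    ratioCorrelation n θ ⟪flatVector k S, flatVector k T⟫ ≤ (1 + y) ^ (S ∩ T).card := by
  have hk0 : (0 : ℝ) < k := by positivity
  have hn0 : (0 : ℝ) < n := by positivity
  have hL : 0 ≤ Real.log (y + 1) := Real.log_nonneg (by linarith)
  rw [inner_flatVector]
  set r : ℝ := ((S ∩ T).card : ℝ) with hr
  have hr0 : 0 ≤ r := Nat.cast_nonneg _
  have hrk : r ≤ k := by
    rw [hr, ← hS]; exact_mod_cast Finset.card_le_card Finset.inter_subset_left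
  have hc1 : r / k ≤ 1 := (div_le_one hk0).2 hrk
  have hc0 : 0 ≤ r / k := by positivity
  have hc2 : (r / k) ^ 2 ≤ r / k := by nlinarith
  have h1 : θ ^ 2 ≤ 1 / 2 := by
    have := pow_le_pow_left₀ hθ.le hθ2.le 2
    rwa [div_pow, Real.sq_sqrt (by norm_num), one_pow] at this
  have h2 : n * θ ^ 2 ≤ k * Real.log (y + 1) := by
    have := (Real.lt_sqrt hθ.le).1 hθy
    rw [lt_div_iff₀ hn0] at this
    linarith
  have h3 : θ ^ 2 * (r / k) ^ 2 ≤ 1 / 2 := by nlinarith [sq_nonneg θ]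
  refine (ratioCorrelation_le_exp n h3).trans ?_
  rw [← Real.exp_log (show 0 < 1 + y by linarith), ← Real.exp_nat_mul, Real.exp_le_exp, ← hr,
    add_comm 1 y]
  calc (n : ℝ) * (θ ^ 2 * (r / k) ^ 2) = (n * θ ^ 2) * (r / k) ^ 2 := by ring
    _ ≤ (k * Real.log (y + 1)) * (r / k) :=
        mul_le_mul h2 hc2 (by positivity) (by positivity)
    _ = r * Real.log (y + 1) := by field_simp

/-! ### The lower bound -/

/-- The likelihood ratio of the mixture of the spiked laws over the uniform prior. -/
noncomputable def mixtureRatio (p n k : ℕ) (θ : ℝ) (x : Fin n → EuclideanSpace ℝ (Fin p)) : ℝ :=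
  ((p.choose k : ℝ))⁻¹ *
    ∑ S ∈ Finset.powersetCard k (Finset.univ : Finset (Fin p)), sampleRatio n θ (flatVector k S) x

section Mixture

variable {n k : ℕ} {θ : ℝ} (hk : 1 ≤ k) (hθ : 0 < θ) (hθ1 : θ < 1)
include hk hθ hθ1

lemma memLp_mixtureRatio : MemLp (mixtureRatio p n k θ) 2 (nullLaw p n) := by
  refine MemLp.const_mul ?_ _
  exact memLp_finsetSum _ fun S hS =>
    memLp_sampleRatio n hθ hθ1 (norm_flatVector hk (Finset.mem_powersetCard.1 hS).2)

lemma setIntegral_mixtureRatio {A : Set (Fin n → EuclideanSpace ℝ (Fin p))}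
    (hA : MeasurableSet A) :
    ∫ x in A, mixtureRatio p n k θ x ∂(nullLaw p n) = ((p.choose k : ℝ))⁻¹ *
      ∑ S ∈ Finset.powersetCard k (Finset.univ : Finset (Fin p)),
        (spikedLaw n θ (flatVector k S)).real A := by
  unfold mixtureRatio
  have hnorm : ∀ S ∈ Finset.powersetCard k (Finset.univ : Finset (Fin p)),
      ‖flatVector k S‖ = 1 := fun S hS => norm_flatVector hk (Finset.mem_powersetCard.1 hS).2
  rw [integral_const_mul, integral_finsetSum _ fun S hS =>
    ((memLp_sampleRatio n hθ hθ1 (hnorm S hS)).integrable (by norm_num)).integrableOn]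
  congr 1
  exact Finset.sum_congr rfl fun S hS =>
    (spikedLaw_real_eq_setIntegral n hθ (hnorm S hS) hA).symm

lemma integral_mixtureRatio (hkp : k ≤ p) : ∫ x, mixtureRatio p n k θ x ∂(nullLaw p n) = 1 := by
  have hN : (p.choose k : ℝ) ≠ 0 := by exact_mod_cast (Nat.choose_pos hkp).ne'
  rw [← setIntegral_univ, setIntegral_mixtureRatio hk hθ hθ1 MeasurableSet.univ]
  simp [hN]

lemma integral_mixtureRatio_sq : ∫ x, mixtureRatio p n k θ x ^ 2 ∂(nullLaw p n) =
    ((p.choose k : ℝ))⁻¹ ^ 2 * ∑ S ∈ Finset.powersetCard k (Finset.univ : Finset (Fin p)),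
      ∑ T ∈ Finset.powersetCard k (Finset.univ : Finset (Fin p)),
        ratioCorrelation n θ ⟪flatVector k S, flatVector k T⟫ := by
  have hnorm : ∀ S ∈ Finset.powersetCard k (Finset.univ : Finset (Fin p)),
      ‖flatVector k S‖ = 1 := fun S hS => norm_flatVector hk (Finset.mem_powersetCard.1 hS).2
  have hint : ∀ S ∈ Finset.powersetCard k (Finset.univ : Finset (Fin p)),
      ∀ T ∈ Finset.powersetCard k (Finset.univ : Finset (Fin p)),
      Integrable (fun x => sampleRatio n θ (flatVector k S) x * sampleRatio n θ (flatVector k T) x)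
        (nullLaw p n) := fun S hS T hT =>
    (memLp_sampleRatio n hθ hθ1 (hnorm S hS)).integrable_mul
      (memLp_sampleRatio n hθ hθ1 (hnorm T hT))
  simp_rw [mixtureRatio, mul_pow, sq (Finset.sum _ _), Finset.sum_mul_sum]
  rw [integral_const_mul, integral_finsetSum _ fun S hS => integrable_finsetSum _ (hint S hS)]
  congr 1
  refine Finset.sum_congr rfl fun S hS => ?_
  rw [integral_finsetSum _ (hint S hS)]
  exact Finset.sum_congr rfl fun T hT =>
    integral_sampleRatio_mul n hθ hθ1 (hnorm S hS) (hnorm T hT)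

end Mixture

lemma lt_one_of_lt_one_div_sqrt_two {θ : ℝ} (h : θ < 1 / √2) : θ < 1 :=
  h.trans ((div_lt_one (by positivity)).2 (Real.lt_sqrt_of_sq_lt (by norm_num)))

/-- Below the detection level with constant `C`, the second moment of the mixture likelihood ratio
is at most `(1 + C / k) ^ k ≤ exp C`. -/
lemma integral_mixtureRatio_sq_le {n k : ℕ} (hn : 1 ≤ n) (hk : 1 ≤ k) (hkp : k ≤ p) {θ C : ℝ}
    (hθ : 0 < θ) (hC : 0 ≤ C) (hθC : θ < √(k * Real.log (C * p / k ^ 2 + 1) / n))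
    (hθ2 : θ < 1 / √2) :
    ∫ x, mixtureRatio p n k θ x ^ 2 ∂(nullLaw p n) ≤ Real.exp C := by
  have hk0 : (0 : ℝ) < k := by positivity
  have hp0 : (0 : ℝ) < p := by exact_mod_cast (by omega : 0 < p)
  have hN : (0 : ℝ) < p.choose k := by exact_mod_cast Nat.choose_pos hkp
  rw [integral_mixtureRatio_sq hk hθ (lt_one_of_lt_one_div_sqrt_two hθ2)]
  have hinner : ∀ S ∈ Finset.powersetCard k (Finset.univ : Finset (Fin p)),
      ∑ T ∈ Finset.powersetCard k (Finset.univ : Finset (Fin p)),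
        ratioCorrelation n θ ⟪flatVector k S, flatVector k T⟫ ≤
      (p.choose k : ℝ) * Real.exp C := by
    intro S hS
    have hScard := (Finset.mem_powersetCard.1 hS).2
    have hy : 0 ≤ C * p / (k : ℝ) ^ 2 := by positivity
    refine (Finset.sum_le_sum fun T _ =>
      ratioCorrelation_flatVector_le hn hk hθ hy hθC hθ2 hScard).trans ?_
    refine (sum_pow_card_inter_le hkp hScard hy).trans ?_
    refine mul_le_mul_of_nonneg_left ?_ hN.le
    have e : (k : ℝ) / p * (C * p / k ^ 2) = C / k := by field_simp
    rw [e]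
    calc (1 + C / k) ^ k ≤ Real.exp (C / k) ^ k :=
          pow_le_pow_left₀ (by positivity) (by linarith [Real.add_one_le_exp (C / k)]) k
      _ = Real.exp C := by rw [← Real.exp_nat_mul]; congr 1; field_simp
  have hsum := Finset.sum_le_sum hinner
  rw [Finset.sum_const, Finset.card_powersetCard, Finset.card_univ, Fintype.card_fin,
    nsmul_eq_mul] at hsum
  calc _ ≤ ((p.choose k : ℝ))⁻¹ ^ 2 * (p.choose k * (p.choose k * Real.exp C)) :=
        mul_le_mul_of_nonneg_left hsum (by positivity)
    _ = Real.exp C := by field_simp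

lemma detectionConst_pos {ν : ℝ} (hν : 0 < ν) : 0 < detectionConst ν := by
  have h : 1 < 1 + 8 * ν ^ 2 := by linarith [pow_pos hν 2]
  unfold detectionConst
  split_ifs
  · exact Real.log_pos (lt_max_of_lt_left h)
  · exact Real.log_pos h

section Errors

variable {n : ℕ} (ψ : Test p n)

lemma measurableSet_test_eq (j : Fin 2) : MeasurableSet {x | ψ.1 x = j} :=
  ψ.2 (measurableSet_singleton j)

lemma typeIIError_le_iSup {k : ℕ} (θ : ℝ) {v : EuclideanSpace ℝ (Fin p)}
    (hv : v ∈ sparseSphere p k) :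
    typeIIError θ ψ v ≤ ⨆ v : sparseSphere p k, typeIIError θ ψ v :=
  le_ciSup (f := fun v : sparseSphere p k => typeIIError θ ψ v)
    ⟨1, by rintro _ ⟨v, rfl⟩; exact measureReal_le_one⟩ ⟨v, hv⟩

lemma half_sub_le_worstCaseError {k : ℕ} {ν θ : ℝ} (hν : 0 < ν) (hn : 1 ≤ n) (hk : 1 ≤ k)
    (hkp : k ≤ p) (hθ : 0 < θ) (hlevel : θ < detectionLevel ν p n k) :
    1 / 2 - ν ≤ worstCaseError k θ ψ := by
  have hm0 : 0 ≤ worstCaseError k θ ψ := le_max_of_le_left measureReal_nonneg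
  by_cases hν2 : ν < 1 / 2
  swap
  · linarith
  obtain ⟨hθC, hθ2⟩ := lt_min_iff.1 hlevel
  have hθ1 := lt_one_of_lt_one_div_sqrt_two hθ2
  have hN : (0 : ℝ) < p.choose k := by exact_mod_cast Nat.choose_pos hkp
  have hA := measurableSet_test_eq ψ 1
  have hcompl : {x | ψ.1 x = 1}ᶜ = {x | ψ.1 x = 0} := by
    ext x
    simp only [Set.mem_compl_iff, Set.mem_ofPred_eq]
    omega
  have hchi := sq_one_sub_errors_le (memLp_mixtureRatio (p := p) (n := n) hk hθ hθ1)
    (integral_mixtureRatio hk hθ hθ1 hkp) hA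
  set α := Real.exp (detectionConst ν) - 1 with hα
  have hα0 : 0 ≤ α := by linarith [Real.add_one_le_exp (detectionConst ν), detectionConst_pos hν]
  have hmoment : ∫ x, mixtureRatio p n k θ x ^ 2 ∂(nullLaw p n) - 1 ≤ α :=
    sub_le_sub_right (integral_mixtureRatio_sq_le hn hk hkp hθ (detectionConst_pos hν).le hθC hθ2) 1
  have ha1 : (nullLaw p n).real {x | ψ.1 x = 1} ≤ 1 := measureReal_le_one
  have hchi' := hchi.trans (mul_le_mul_of_nonneg_left hmoment
    (mul_nonneg measureReal_nonneg (sub_nonneg.2 ha1)))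
  refine half_sub_le_of_sq_le hν hν2 (le_max_left _ _) ?_ hchi' ?_ hα0
  · -- the error averaged over the prior is at most the largest one
    rw [setIntegral_mixtureRatio hk hθ hθ1 hA.compl, hcompl, inv_mul_le_iff₀ hN]
    have h := Finset.sum_le_card_nsmul (Finset.powersetCard k (Finset.univ : Finset (Fin p)))
      (fun S => (spikedLaw n θ (flatVector k S)).real {x | ψ.1 x = 0}) (worstCaseError k θ ψ)
      fun S hS => (typeIIError_le_iSup ψ θ (flatVector_mem_sparseSphere hk
        (Finset.mem_powersetCard.1 hS).2)).trans (le_max_right _ _)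
    rwa [Finset.card_powersetCard, Finset.card_univ, Fintype.card_fin, nsmul_eq_mul] at h
  · rw [hα, detectionConst, if_pos hν2, Real.exp_log (lt_max_of_lt_left (by positivity))]
    linarith

end Errors

end SparsePCA

theorem mainTheorem2 (ν : ℝ) (hν : 0 < ν) :
    0 < SparsePCA.detectionConst ν ∧
    ∀ (p n k : ℕ) (θ : ℝ), 1 ≤ n → 1 ≤ k → k ≤ p → 0 < θ →
      θ < SparsePCA.detectionLevel ν p n k →
      -- the largest type II error of every test is attained
      (∀ ψ : SparsePCA.Test p n, ∃ v ∈ SparsePCA.sparseSphere p k,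
        IsMaxOn (SparsePCA.typeIIError θ ψ) (SparsePCA.sparseSphere p k) v) ∧
      1 / 2 - ν ≤ ⨅ ψ : SparsePCA.Test p n, SparsePCA.worstCaseError k θ ψ := by
  refine ⟨SparsePCA.detectionConst_pos hν, fun p n k θ hn hk hkp hθ hlevel => ⟨fun ψ => ?_, ?_⟩⟩
  · have hθ1 := SparsePCA.lt_one_of_lt_one_div_sqrt_two (lt_min_iff.1 hlevel).2
    obtain ⟨S, -, hS⟩ := Finset.exists_subset_card_eq
      (s := (Finset.univ : Finset (Fin p))) (n := k) (by simpa using hkp)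
    exact (SparsePCA.isCompact_sparseSphere p k).exists_isMaxOn
      ⟨_, SparsePCA.flatVector_mem_sparseSphere hk hS⟩
      ((SparsePCA.continuousOn_spikedLaw_real n hθ hθ1
        (SparsePCA.measurableSet_test_eq ψ 0)).mono (SparsePCA.sparseSphere_subset_sphere p k))
  · have : Nonempty (SparsePCA.Test p n) := ⟨⟨fun _ => 0, measurable_const⟩⟩
    exact le_ciInf fun ψ => SparsePCA.half_sub_le_worstCaseError ψ hν hn hk hkp hθ hlevel
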